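/- **Setting.** Let $\beta\ge 1$ be an integer and $L>0$. The Sobolev class $\mathcal W(\beta,L)$ is the set of all $(\beta-1)$-times differentiable functions $f:[0,1]\to\mathbb R$ whose $(\beta-1)$-th derivative is absolutely continuous and for which $\int_0^1 \big(f^{(\beta)}(x)\big)^2\,dx\le L^2$; $\mathcal P_{\mathcal W}(\beta,L)$ is the set of probability densities on $[0,1]$ that belong to $\mathcal W(\beta,L)$. For $\alpha>0$ let $\mathcal Q_\alpha$ be the set of all $\alpha$-differentially locally private mechanisms, that is, of all Markov kernels $Q$ from $[0,1]$ to an arbitrary measurable space $(\mathcal Z,\mathscr Z)$ such that $Q(B\mid x)\le e^{\alpha}\,Q(B\mid x')$ for all $B\in\mathscr Z$ and $x,x'\in[0,1]$. For a density $f$ on $[0,1]$ and $Q\in\mathcal Q_\alpha$, let $\mathbb E_{f,Q}$ denote the expectation when $X_1,\dots,X_n$ are i.i.d. with density $f$ and, given these, the privatised observations $Z_1,\dots,Z_n$ are drawn independently (non-interactively) with $Z_i\sim Q(\cdot\mid X_i)$. **Theorem (Lower bound).** Let $\beta\ge1$ be an integer and $L>0$. There is a constant $C>0$, depending only on $\beta$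 and $L$, such that for all $t\in[0,1]$ and all $\alpha>0$ $$\liminf_{n\to\infty}\ \inf_{T_n}\ \inf_{Q\in\mathcal Q_\alpha}\ \sup_{f\in\mathcal P_{\mathcal W}(\beta,L)} \mathbb E_{f,Q}\Big[\big(n(e^{\alpha}-1)^2\big)^{\frac{2\beta}{2\beta+2}}\,|T_n-f(t)|^2\Big]\ \ge\ C,$$ where $\inf_{T_n}$ is the infimum over all estimators of $f(t)$, i.e. all real-valued measurable functions $T_n=T_n(Z_1,\dots,Z_n)$ of the privatised data, and the quantity on the left may be $+\infty$. -/

import Mathlib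

open MeasureTheory ProbabilityTheory Filter Set
open scoped ENNReal

universe u

noncomputable section

namespace PrivateDensity

/-- The Sobolev class `W(β, L)` on `[0,1]`, for an integer `β ≥ 1`: functions that are `β - 1` times
differentiable on `[0,1]` (one-sided at the end points), whose derivative of order `β - 1` is
absolutely continuous on `[0,1]`, and whose (almost everywhere defined) derivative of order `β`
satisfies `∫₀¹ (f^(β))² ≤ L²`. A function on `[0,1]` is represented by a function on `ℝ`, of which
only the values on `[0,1]` matter. -/
structure IsSobolev (β : ℕ) (L : ℝ) (f : ℝ → ℝ) : Prop where
  differentiableOn : ∀ k : ℕ, k + 1 < β →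
    DifferentiableOn ℝ (iteratedDerivWithin k f (Icc 0 1)) (Icc 0 1)
  absolutelyContinuous :
    AbsolutelyContinuousOnInterval (iteratedDerivWithin (β - 1) f (Icc 0 1)) 0 1
  lintegral_sq_le :
    ∫⁻ x in Icc (0 : ℝ) 1, ENNReal.ofReal (iteratedDerivWithin β f (Icc 0 1) x ^ 2)
      ≤ ENNReal.ofReal (L ^ 2)

/-- `f` is a probability density on `[0,1]`. -/
structure IsDensity (f : ℝ → ℝ) : Prop where
  nonneg : ∀ x ∈ Icc (0 : ℝ) 1, 0 ≤ f x
  integrableOn : IntegrableOn f (Icc 0 1)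
  integral_eq_one : ∫ x in Icc (0 : ℝ) 1, f x = 1

/-- The class of densities on `[0,1]` that belong to the Sobolev class `W(β, L)`. -/
def sobolevDensities (β : ℕ) (L : ℝ) : Set (ℝ → ℝ) :=
  {f | IsDensity f ∧ IsSobolev β L f}

/-- The distribution on `[0,1]` with Lebesgue density `f`. -/
def rawLaw (f : ℝ → ℝ) : Measure (Icc (0 : ℝ) 1) :=
  (volume : Measure (Icc (0 : ℝ) 1)).withDensity fun x => ENNReal.ofReal (f x)

/-- A privacy mechanism (Markov kernel) `Q` is `α`-differentially locally private if
`Q(B | x) ≤ exp(α) Q(B | x')` for all measurable `B` and all inputs `x, x'`. -/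
structure IsLocallyPrivate {X Z : Type*} [MeasurableSpace X] [MeasurableSpace Z]
    (α : ℝ) (Q : Kernel X Z) : Prop where
  isMarkov : IsMarkovKernel Q
  le_exp_mul : ∀ B : Set Z, MeasurableSet B → ∀ x x' : X,
    Q x B ≤ ENNReal.ofReal (Real.exp α) * Q x' B

/-- The law of the privatised sample `(Z₁, …, Zₙ)`, when `X₁, …, Xₙ` are i.i.d. with density `f`
and each `Zᵢ` is drawn from `Q(· | Xᵢ)` (non-interactively). -/
def privateSampleLaw {Z : Type*} [MeasurableSpace Z] (n : ℕ) (f : ℝ → ℝ)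
    (Q : Kernel (Icc (0 : ℝ) 1) Z) : Measure (Fin n → Z) :=
  Measure.pi fun _ => (rawLaw f).bind Q

/-- The normalising factor `(n (exp(α) - 1)²)^(2β / (2β + 2))`. -/
def normalisation (β : ℕ) (α : ℝ) (n : ℕ) : ℝ :=
  ((n : ℝ) * (Real.exp α - 1) ^ 2) ^ ((2 * (β : ℝ)) / (2 * (β : ℝ) + 2))

/-- The normalised private minimax risk for estimating `f t` over the class `P` from `n`
privatised observations. The infimum is over all measurable spaces `Z` of privatised values, all
`α`-differentially locally private mechanisms `Q` with values in `Z` and all estimators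
(measurable functions `T` of the privatised sample); expectations take values in `[0, ∞]`. -/
def normalisedMinimaxRisk (P : Set (ℝ → ℝ)) (β : ℕ) (α t : ℝ) (n : ℕ) : ℝ≥0∞ :=
  ⨅ (Z : Type u) (_ : MeasurableSpace Z) (Q : Kernel (Icc (0 : ℝ) 1) Z)
    (_ : IsLocallyPrivate α Q) (T : (Fin n → Z) → ℝ) (_ : Measurable T),
    ⨆ f ∈ P, ∫⁻ z, ENNReal.ofReal (normalisation β α n * |T z - f t| ^ 2)
      ∂(privateSampleLaw n f Q)

end PrivateDensity

end

/-! Le Cam's two-point method: the uniform density is tested against `1 + g`, where `g` is a bump of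
width `h` and height of order `h ^ β` at `t`, minus its mean. Such a `g` respects the Sobolev bound
for every `h`, moves the value at `t` by order `h ^ β`, and has `L¹` norm at most `h ^ (β + 1)`.
Privacy enters through `IsLocallyPrivate.abs_bind_sub_le`: output laws agree up to factors `1 ± ε`
with `ε = (exp α - 1) h ^ (β + 1)`. It is the `L¹` norm of `g` that counts, which produces the
exponent `2β + 2` in the rate. The squared likelihood ratio then has mean at most `1 + ε²`, and `(1
+ ε²) ^ n` over the sample. Choosing `h` with `n ε² = 1` keeps this below `exp 1`, so no estimator
separates the two densities, and the squared error is of order `h ^ (2β)`, the inverse of the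
normalisation. -/

namespace PrivateDensity

/-! ### Second-moment comparison and the two-point bound. -/

/-- Cauchy-Schwarz against a density with bounded second moment. -/
theorem sq_lintegral_withDensity_le {Z : Type*} [MeasurableSpace Z] {M : Measure Z}
    {ρ : Z → ℝ≥0∞} (hρ : Measurable ρ) {K : ℝ≥0∞} (hK : ∫⁻ z, ρ z ^ 2 ∂M ≤ K)
    {F : Z → ℝ≥0∞} (hF : Measurable F) :
    (∫⁻ z, F z ∂(M.withDensity ρ)) ^ 2 ≤ K * ∫⁻ z, F z ^ 2 ∂M := by
  rw [lintegral_withDensity_eq_lintegral_mul _ hρ hF]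
  have h := ENNReal.lintegral_mul_le_Lp_mul_Lq M Real.HolderConjugate.two_two
    hρ.aemeasurable hF.aemeasurable
  have hsq : ∀ x : ℝ≥0∞, (x ^ (1 / (2 : ℝ))) ^ 2 = x := fun x => by
    rw [← ENNReal.rpow_natCast, ← ENNReal.rpow_mul]; norm_num
  calc _ ≤ _ := pow_le_pow_left' h 2
    _ = (∫⁻ z, ρ z ^ 2 ∂M) * ∫⁻ z, F z ^ 2 ∂M := by
      rw [mul_pow, hsq, hsq]; simp only [ENNReal.rpow_two]
    _ ≤ _ := by gcongr

/-- A second-moment comparison of two probability measures tensorizes. -/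
theorem sq_lintegral_pi_le {Z : Type*} [MeasurableSpace Z] {P Q : Measure Z}
    [IsProbabilityMeasure P] [IsProbabilityMeasure Q] {K : ℝ≥0∞}
    (h : ∀ F : Z → ℝ≥0∞, Measurable F → (∫⁻ z, F z ∂P) ^ 2 ≤ K * ∫⁻ z, F z ^ 2 ∂Q)
    (n : ℕ) (F : (Fin n → Z) → ℝ≥0∞) (hF : Measurable F) :
    (∫⁻ z, F z ∂(Measure.pi fun _ => P)) ^ 2
      ≤ K ^ n * ∫⁻ z, F z ^ 2 ∂(Measure.pi fun _ => Q) := by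
  induction n with
  | zero => 
    rw [Measure.pi_of_empty (fun _ : Fin 0 => P), Measure.pi_of_empty (fun _ : Fin 0 => Q),
      lintegral_dirac' _ hF, lintegral_dirac' _ (hF.pow_const 2)]
    simp
  | succ n ih =>
    have key : ∀ (M : Measure Z) [IsProbabilityMeasure M] (G : (Fin (n + 1) → Z) → ℝ≥0∞),
        Measurable G → ∫⁻ z, G z ∂(Measure.pi fun _ => M)
          = ∫⁻ x, ∫⁻ w, G (Fin.cons x w) ∂(Measure.pi fun _ : Fin n => M) ∂M := by
      intro M _ G hG
      have hmp := (measurePreserving_piFinSuccAbove (fun _ : Fin (n + 1) => M) 0).symm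
      have hm : Measurable fun p => G ((MeasurableEquiv.piFinSuccAbove (fun _ => Z) 0).symm p) :=
        hG.comp hmp.measurable
      rw [← hmp.lintegral_comp hG, lintegral_prod _ hm.aemeasurable]
      simp [MeasurableEquiv.piFinSuccAbove, Fin.insertNthEquiv]
    have hcons : Measurable fun p : Z × (Fin n → Z) => (Fin.cons p.1 p.2 : Fin (n + 1) → Z) := by
      refine measurable_pi_iff.2 fun i => ?_
      refine Fin.cases ?_ (fun j => ?_) i
      · simpa using measurable_fst
      · simpa [Function.comp_def] using (measurable_pi_apply j).comp measurable_snd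
    have hFc : Measurable fun p : Z × (Fin n → Z) => F (Fin.cons p.1 p.2) := hF.comp hcons
    rw [key P F hF, key Q _ (hF.pow_const 2)]
    -- The hypothesis handles the first coordinate, the induction hypothesis the remaining `n`
    -- inside the integral.
    calc _ ≤ K * ∫⁻ x, (∫⁻ w, F (Fin.cons x w) ∂(Measure.pi fun _ => P)) ^ 2 ∂Q :=
          h _ hFc.lintegral_prod_right'
      _ ≤ K * ∫⁻ x, K ^ n * ∫⁻ w, F (Fin.cons x w) ^ 2 ∂(Measure.pi fun _ => Q) ∂Q := by
          gcongr with x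
          exact ih (fun w => F (Fin.cons x w)) (hFc.comp measurable_prodMk_left)
      _ = _ := by
          rw [lintegral_const_mul _ (hFc.pow_const 2).lintegral_prod_right', ← mul_assoc, pow_succ']

/-- If `M₁` is within a factor `1 ± ε` of `M₀`, it has a density whose second moment is at most
`1 + ε²`. -/
theorem sq_lintegral_le_of_near {Z : Type*} [MeasurableSpace Z] {M₀ M₁ : Measure Z}
    [IsProbabilityMeasure M₀] [IsProbabilityMeasure M₁] {ε : ℝ} (h0 : 0 ≤ ε) (h1 : ε ≤ 1)
    (hle : ∀ B, MeasurableSet B → M₁.real B ≤ (1 + ε) * M₀.real B)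
    (hge : ∀ B, MeasurableSet B → (1 - ε) * M₀.real B ≤ M₁.real B)
    {F : Z → ℝ≥0∞} (hF : Measurable F) :
    (∫⁻ z, F z ∂M₁) ^ 2 ≤ ENNReal.ofReal (1 + ε ^ 2) * ∫⁻ z, F z ^ 2 ∂M₀ := by
  have hle' : ∀ B, MeasurableSet B → M₁ B ≤ ENNReal.ofReal (1 + ε) * M₀ B := fun B hB => by
    rw [← ofReal_measureReal (μ := M₁), ← ofReal_measureReal (μ := M₀),
      ← ENNReal.ofReal_mul (by linarith)]
    exact ENNReal.ofReal_le_ofReal (hle B hB)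
  have hge' : ∀ B, MeasurableSet B → ENNReal.ofReal (1 - ε) * M₀ B ≤ M₁ B := fun B hB => by
    rw [← ofReal_measureReal (μ := M₁), ← ofReal_measureReal (μ := M₀),
      ← ENNReal.ofReal_mul (by linarith)]
    exact ENNReal.ofReal_le_ofReal (hge B hB)
  have hac : M₁ ≪ M₀ := Measure.AbsolutelyContinuous.mk fun B hB hB0 => by
    simpa [hB0] using hle' B hB
  set ρ := M₁.rnDeriv M₀ with hρdef
  have hρ : Measurable ρ := Measure.measurable_rnDeriv _ _
  have hM : M₀.withDensity ρ = M₁ := Measure.withDensity_rnDeriv_eq _ _ hac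
  have hset : ∀ B, MeasurableSet B → ∫⁻ z in B, ρ z ∂M₀ = M₁ B := fun B hB => by
    rw [← withDensity_apply _ hB, hM]
  have hup : ∀ᵐ z ∂M₀, ρ z ≤ ENNReal.ofReal (1 + ε) :=
    ae_le_of_forall_setLIntegral_le_of_sigmaFinite hρ fun B hB _ => by
      rw [hset B hB, setLIntegral_const]; exact hle' B hB
  have hlo : ∀ᵐ z ∂M₀, ENNReal.ofReal (1 - ε) ≤ ρ z :=
    ae_le_of_forall_setLIntegral_le_of_sigmaFinite measurable_const fun B hB _ => by
      rw [hset B hB, setLIntegral_const]; exact hge' B hB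
  -- This is `(ρ - (1 - ε)) (1 + ε - ρ) ≥ 0`, arranged without subtracting `ρ`; as `ρ` has mean one,
  -- integrating gives the bound `1 + ε²`.
  have hpt : ∀ᵐ z ∂M₀, ρ z ^ 2 + ENNReal.ofReal (1 - ε ^ 2) ≤ 2 * ρ z := by
    filter_upwards [hup, hlo] with z hz1 hz2
    have hfin : ρ z ≠ ∞ := (hz1.trans_lt ENNReal.ofReal_lt_top).ne
    lift ρ z to NNReal using hfin with r
    rw [← ENNReal.ofReal_coe_nnreal] at hz1 hz2 ⊢
    have a1 := (ENNReal.ofReal_le_ofReal_iff (by linarith)).1 hz1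
    have a2 := (ENNReal.ofReal_le_ofReal_iff r.coe_nonneg).1 hz2
    have h2 : (2 : ℝ≥0∞) = ENNReal.ofReal 2 := by simp
    rw [h2, ← ENNReal.ofReal_pow r.coe_nonneg, ← ENNReal.ofReal_add (by positivity) (by nlinarith),
      ← ENNReal.ofReal_mul (by norm_num)]
    apply ENNReal.ofReal_le_ofReal
    nlinarith [mul_nonneg (sub_nonneg.2 a1) (sub_nonneg.2 a2)]
  have hint := lintegral_mono_ae hpt
  rw [lintegral_add_right _ measurable_const, lintegral_const_mul _ hρ, lintegral_const] at hint
  have htot : ∫⁻ z, ρ z ∂M₀ = 1 := by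
    rw [← setLIntegral_univ, hset _ MeasurableSet.univ, measure_univ]
  rw [htot, measure_univ, mul_one, mul_one] at hint
  have hK : ∫⁻ z, ρ z ^ 2 ∂M₀ ≤ ENNReal.ofReal (1 + ε ^ 2) := by
    have hε : ε ^ 2 ≤ 1 := by nlinarith
    have : ENNReal.ofReal (1 + ε ^ 2) + ENNReal.ofReal (1 - ε ^ 2) = 2 := by
      rw [← ENNReal.ofReal_add (by positivity) (by linarith)]; norm_num
    exact (ENNReal.add_le_add_iff_right ENNReal.ofReal_ne_top).1 (hint.trans_eq this.symm)
  simpa only [hM] using sq_lintegral_withDensity_le hρ hK hF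

/-- Le Cam's two-point bound under a second-moment comparison. -/
theorem two_point_bound {Ω : Type*} [MeasurableSpace Ω] {P₀ P₁ : Measure Ω}
    [IsProbabilityMeasure P₁] {K : ℝ} (hK : 1 ≤ K)
    (h : ∀ F : Ω → ℝ≥0∞, Measurable F →
      (∫⁻ z, F z ∂P₁) ^ 2 ≤ ENNReal.ofReal K * ∫⁻ z, F z ^ 2 ∂P₀)
    {T : Ω → ℝ} (hT : Measurable T) {a b δ s : ℝ} (hδ : 0 ≤ δ) (hs : 0 ≤ s)
    (hab : 2 * δ ≤ |b - a|) :
    ENNReal.ofReal (s * δ ^ 2 / (4 * K)) ≤ ∫⁻ z, ENNReal.ofReal (s * |T z - a| ^ 2) ∂P₀ ∨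
    ENNReal.ofReal (s * δ ^ 2 / (4 * K)) ≤ ∫⁻ z, ENNReal.ofReal (s * |T z - b| ^ 2) ∂P₁ := by
  have hKpos : 0 < K := by linarith
  have markov : ∀ (P : Measure Ω) (A : Set Ω) (c : ℝ), MeasurableSet A →
      (∀ z ∈ A, δ ≤ |T z - c|) → ENNReal.ofReal (1 / (4 * K)) ≤ P A →
      ENNReal.ofReal (s * δ ^ 2 / (4 * K)) ≤ ∫⁻ z, ENNReal.ofReal (s * |T z - c| ^ 2) ∂P := by
    intro P A c hA hAc hPA
    calc _ = ENNReal.ofReal (s * δ ^ 2) * ENNReal.ofReal (1 / (4 * K)) := by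
          rw [← ENNReal.ofReal_mul (by positivity)]; ring_nf
      _ ≤ ENNReal.ofReal (s * δ ^ 2) * P A := by gcongr
      _ = ∫⁻ z in A, ENNReal.ofReal (s * δ ^ 2) ∂P := by rw [setLIntegral_const]
      _ ≤ ∫⁻ z in A, ENNReal.ofReal (s * |T z - c| ^ 2) ∂P := by
          refine setLIntegral_mono' hA fun z hz => ENNReal.ofReal_le_ofReal ?_
          have := hAc z hz
          gcongr
      _ ≤ _ := setLIntegral_le_lintegral _ _
  set A : Set Ω := {z | |T z - b| < δ} with hAdef
  have hA : MeasurableSet A := measurableSet_lt (hT.sub_const b).abs measurable_const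
  -- If `T` is near `b` with `P₁`-probability at least `1/2`, Cauchy-Schwarz gives that event
  -- `P₀`-mass at least `1 / (4K)`, and there `T` is far from `a`. Otherwise `T` misses `b` often
  -- under `P₁`.
  by_cases hP : ENNReal.ofReal (1 / 2) ≤ P₁ A
  · left
    refine markov P₀ A a hA (fun z hz => ?_) ?_
    · have hz' : |T z - b| < δ := hz
      have : |b - a| ≤ |T z - a| + |T z - b| := by
        calc |b - a| = |(T z - a) - (T z - b)| := by ring_nf
          _ ≤ _ := abs_sub _ _
      linarith
    · have h2 := h (A.indicator 1) (measurable_one.indicator hA)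
      have e : (fun z => (A.indicator (1 : Ω → ℝ≥0∞) z) ^ 2) = A.indicator 1 := by
        funext z; by_cases hz : z ∈ A <;> simp [hz]
      rw [e, lintegral_indicator_one hA, lintegral_indicator_one hA] at h2
      have h3 : ENNReal.ofReal (1 / 4) ≤ ENNReal.ofReal K * P₀ A := by
        refine le_trans ?_ ((pow_le_pow_left' hP 2).trans h2)
        rw [← ENNReal.ofReal_pow (by norm_num)]; norm_num
      have hmul : ENNReal.ofReal (1 / (4 * K)) = ENNReal.ofReal (1 / K) * ENNReal.ofReal (1 / 4) := by
        rw [← ENNReal.ofReal_mul (by positivity)]; congr 1; field_simp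
      calc _ ≤ ENNReal.ofReal (1 / K) * (ENNReal.ofReal K * P₀ A) := by rw [hmul]; gcongr
        _ = P₀ A := by
          rw [← mul_assoc, ← ENNReal.ofReal_mul (by positivity), one_div_mul_cancel hKpos.ne']
          simp
  · right
    refine markov P₁ Aᶜ b hA.compl (fun z hz => not_lt.1 hz) ?_
    rw [prob_compl_eq_one_sub hA]
    push Not at hP
    have : ENNReal.ofReal (1 / (4 * K)) + ENNReal.ofReal (1 / 2) ≤ 1 := by
      rw [← ENNReal.ofReal_add (by positivity) (by norm_num), ENNReal.ofReal_le_one]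
      have : 1 / (4 * K) ≤ 1 / 4 := by
        apply one_div_le_one_div_of_le <;> linarith
      linarith
    exact ENNReal.le_sub_of_add_le_right (measure_ne_top _ _) ((add_le_add_right hP.le _).trans this)

/-! ### Contraction under local privacy. -/

/-- Strong contraction of a locally private channel: a mean-zero perturbation `g` of the uniform
density changes the probability of an output event by at most the factor
`1 ± (exp α - 1) ‖g‖₁`. -/
theorem IsLocallyPrivate.abs_bind_sub_le {X Z : Type*} [MeasurableSpace X] [MeasurableSpace Z]
    {α : ℝ} {Q : Kernel X Z} (hQ : IsLocallyPrivate α Q) (hα : 0 < α) {μ : Measure X}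
    [IsProbabilityMeasure μ] {g : X → ℝ} (hgm : Measurable g) (hg : Integrable g μ)
    (hg0 : ∫ x, g x ∂μ = 0) (hpos : ∀ x, 0 ≤ 1 + g x) {B : Set Z} (hB : MeasurableSet B) :
    |((μ.withDensity fun x => ENNReal.ofReal (1 + g x)).bind Q).real B - (μ.bind Q).real B|
      ≤ (Real.exp α - 1) * (∫ x, |g x| ∂μ) * (μ.bind Q).real B := by
  have := hQ.isMarkov
  set q : X → ℝ := fun x => (Q x).real B with hq
  have hqm : Measurable q := (Q.measurable_coe hB).ennreal_toReal
  have hq0 : ∀ x, 0 ≤ q x := fun x => measureReal_nonneg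
  have hq1 : ∀ x, q x ≤ 1 := fun x => measureReal_le_one
  have hqb : ∀ x, ‖q x‖ ≤ 1 := fun x => by rw [Real.norm_of_nonneg (hq0 x)]; exact hq1 x
  have hqi : Integrable q μ := .of_bound hqm.aestronglyMeasurable 1 (.of_forall hqb)
  have hqg : Integrable (fun x => q x * g x) μ :=
    hg.bdd_mul hqm.aestronglyMeasurable (.of_forall hqb)
  have hbind : ∀ ν : Measure X, (ν.bind Q).real B = ∫ x, q x ∂ν := fun ν => by
    rw [measureReal_def, Measure.bind_apply hB Q.measurable.aemeasurable,
      ← integral_toReal (Q.measurable_coe hB).aemeasurable (.of_forall fun x => measure_lt_top _ _)]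
    rfl
  have hdens : ((μ.withDensity fun x => ENNReal.ofReal (1 + g x)).bind Q).real B
      = ∫ x, q x ∂μ + ∫ x, q x * g x ∂μ := by
    rw [hbind, integral_withDensity_eq_integral_toReal_smul (by fun_prop) (by simp),
      ← integral_add hqi hqg]
    refine integral_congr_ae (.of_forall fun x => ?_)
    simp only [ENNReal.toReal_ofReal (hpos x), smul_eq_mul]; ring
  have hexp : ∀ x y, q x ≤ Real.exp α * q y := fun x y => by
    have := ENNReal.toReal_mono (by finiteness) (hQ.le_exp_mul B hB x y)
    rwa [ENNReal.toReal_mul, ENNReal.toReal_ofReal (Real.exp_nonneg _)] at this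
  have hdiff : ∀ x y, |q x - q y| ≤ (Real.exp α - 1) * q y := fun x y => by
    have he : 1 ≤ Real.exp α := Real.one_le_exp hα.le
    rw [abs_le]
    constructor
    · by_cases hxy : q x ≤ q y
      · nlinarith [hexp y x]
      · nlinarith [hq0 y]
    · linarith [hexp x y]
  -- Since `g` has mean zero, the constant `q y` can be subtracted from `q`; averaging over `y`
  -- later turns `q y` into the output probability of `B`.
  have hy : ∀ y, |∫ x, q x * g x ∂μ| ≤ (Real.exp α - 1) * (∫ x, |g x| ∂μ) * q y := fun y => by
    have e : ∫ x, q x * g x ∂μ = ∫ x, (q x - q y) * g x ∂μ := by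
      simp_rw [sub_mul]
      rw [integral_sub hqg (hg.const_mul _), integral_const_mul, hg0]; ring
    rw [e]
    calc _ ≤ ∫ x, |(q x - q y) * g x| ∂μ := abs_integral_le_integral_abs
      _ ≤ ∫ x, ((Real.exp α - 1) * q y) * |g x| ∂μ := by
          refine integral_mono_of_nonneg (.of_forall fun x => abs_nonneg _)
            (hg.abs.const_mul _) (.of_forall fun x => ?_)
          simp only [abs_mul]
          exact mul_le_mul_of_nonneg_right (hdiff x y) (abs_nonneg _)
      _ = _ := by rw [integral_const_mul]; ring
  rw [hdens, hbind, add_sub_cancel_left]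
  calc _ = ∫ _, |∫ x, q x * g x ∂μ| ∂μ := by simp
    _ ≤ ∫ y, (Real.exp α - 1) * (∫ x, |g x| ∂μ) * q y ∂μ :=
        integral_mono (integrable_const _) (hqi.const_mul _) hy
    _ = _ := by rw [integral_const_mul]

/-! ### Smooth perturbations of the uniform density. -/

theorem contDiff_iteratedDeriv {f : ℝ → ℝ} (hf : ContDiff ℝ (⊤ : ℕ∞) f) (k : ℕ) :
    ContDiff ℝ 1 (iteratedDeriv k f) := by
  rw [iteratedDeriv_eq_iterate]
  exact (hf.of_le (by exact_mod_cast le_top)).iterate_deriv' 1 k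

theorem isSobolev_of_contDiff {β : ℕ} {L : ℝ} {f : ℝ → ℝ} (hf : ContDiff ℝ (⊤ : ℕ∞) f)
    (hL : ∀ x, |iteratedDeriv β f x| ≤ L) : IsSobolev β L f := by
  have hu : UniqueDiffOn ℝ (Icc (0 : ℝ) 1) := uniqueDiffOn_Icc one_pos
  have heq : ∀ k : ℕ, EqOn (iteratedDerivWithin k f (Icc 0 1)) (iteratedDeriv k f) (Icc 0 1) :=
    fun k x hx => iteratedDerivWithin_eq_iteratedDeriv hu
      (hf.of_le (by exact_mod_cast le_top)).contDiffAt hx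
  have hsm : ∀ k : ℕ, ContDiffOn ℝ 1 (iteratedDerivWithin k f (Icc 0 1)) (Icc 0 1) := fun k => by
    exact (contDiff_iteratedDeriv hf k).contDiffOn.congr (heq k)
  refine ⟨fun k _ => (hsm k).differentiableOn one_ne_zero, ?_, ?_⟩
  · refine ContDiffOn.absolutelyContinuousOnInterval ?_
    rw [uIcc_of_le zero_le_one]; exact hsm _
  · calc _ ≤ ∫⁻ _ in Icc (0 : ℝ) 1, ENNReal.ofReal (L ^ 2) := by
          refine setLIntegral_mono' measurableSet_Icc fun x hx => ENNReal.ofReal_le_ofReal ?_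
          rw [heq β hx]
          exact sq_le_sq' (abs_le.1 (hL x)).1 (abs_le.1 (hL x)).2
      _ = _ := by simp

theorem one_mem_sobolevDensities {β : ℕ} (hβ : 1 ≤ β) {L : ℝ} (hL : 0 < L) :
    (fun _ => 1) ∈ sobolevDensities β L := by
  refine ⟨⟨fun _ _ => zero_le_one, integrableOn_const (by simp), by simp⟩,
    isSobolev_of_contDiff contDiff_const fun x => ?_⟩
  rw [iteratedDeriv_const, if_neg (by lia)]; simpa using hL.le

/-- A scaled bump. -/
theorem exists_bump (β : ℕ) {L : ℝ} (hL : 0 < L) :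
    ∃ (φ : ℝ → ℝ) (c : ℝ), ContDiff ℝ (⊤ : ℕ∞) φ ∧ 0 < c ∧ c ≤ 1 / 4 ∧ φ 0 = c ∧
      (∀ x, 0 ≤ φ x) ∧ (∀ x, φ x ≤ c) ∧ (∀ x, 1 < |x| → φ x = 0) ∧
      ∀ x, |iteratedDeriv β φ x| ≤ L := by
  let b : ContDiffBump (0 : ℝ) := ⟨1 / 2, 1, by norm_num, by norm_num⟩
  have hb : ContDiff ℝ (⊤ : ℕ∞) b := b.contDiff
  have hcont : Continuous (iteratedDeriv β b) := (contDiff_iteratedDeriv hb β).continuous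
  have hzero : ∀ x, x ∉ Metric.closedBall (0 : ℝ) 1 → iteratedDeriv β b x = 0 := fun x hx => by
    have : (b : ℝ → ℝ) =ᶠ[nhds x] fun _ => 0 := by
      filter_upwards [Metric.isClosed_closedBall.isOpen_compl.mem_nhds hx] with y hy
      exact b.zero_of_le_dist (le_of_lt (not_le.1 hy))
    rw [this.iteratedDeriv_eq, iteratedDeriv_const]; simp
  obtain ⟨M, hM⟩ := (isCompact_closedBall (0 : ℝ) 1).exists_bound_of_continuousOn hcont.continuousOn
  have hM0 : 0 ≤ M := (norm_nonneg _).trans (hM 0 (by simp))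
  have hMall : ∀ x, |iteratedDeriv β b x| ≤ M := fun x => by
    by_cases hx : x ∈ Metric.closedBall (0 : ℝ) 1
    · exact hM x hx
    · simpa [hzero x hx] using hM0
  -- The bound `1/4` later controls the `L¹` norm; `M + 1` avoids dividing by zero.
  set c := min (1 / 4) (L / (M + 1)) with hc
  have hcpos : 0 < c := lt_min (by norm_num) (by positivity)
  refine ⟨fun x => c * b x, c, contDiff_const.mul hb, hcpos, min_le_left _ _, ?_, fun x => ?_,
    fun x => ?_, fun x hx => ?_, fun x => ?_⟩
  · simp [b.one_of_mem_closedBall (x := 0) (Metric.mem_closedBall_self b.rIn_pos.le)]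
  · exact mul_nonneg hcpos.le b.nonneg
  · exact mul_le_of_le_one_right hcpos.le b.le_one
  · simp only [b.zero_of_le_dist (x := x) (by simpa using hx.le), mul_zero]
  · rw [iteratedDeriv_const_mul_field, abs_mul, abs_of_pos hcpos]
    calc c * |iteratedDeriv β b x| ≤ L / (M + 1) * (M + 1) := by
          gcongr
          · exact min_le_right _ _
          · linarith [hMall x]
      _ = L := div_mul_cancel₀ _ (by positivity)

/-- Perturbations of the uniform density, of height of order `h ^ β` at the point `t` and
`L¹`-norm at most `h ^ (β + 1)`. -/
theorem exists_perturbation {β : ℕ} (hβ : 1 ≤ β) {L : ℝ} (hL : 0 < L) :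
    ∃ c : ℝ, 0 < c ∧ ∀ t ∈ Icc (0 : ℝ) 1, ∀ h : ℝ, 0 < h → h ≤ 1 / 4 → ∃ g : ℝ → ℝ,
      Continuous g ∧ ∫ x in Icc (0 : ℝ) 1, g x = 0 ∧
      (fun x => 1 + g x) ∈ sobolevDensities β L ∧ c * h ^ β ≤ |g t| ∧
      ∫ x in Icc (0 : ℝ) 1, |g x| ≤ h ^ (β + 1) := by
  obtain ⟨φ, c, hφ, hc, hc4, hφ0, hφnn, hφc, hφz, hφd⟩ := exists_bump β hL
  refine ⟨c / 2, by positivity, fun t ht h hh hh4 => ?_⟩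
  -- The factor `h ^ β` cancels the `h⁻¹ ^ β` from differentiating, so the derivative bound is
  -- uniform in `h`.
  set p : ℝ → ℝ := fun x => h ^ β * φ (h⁻¹ * (x - t)) with hp
  have hpsm : ContDiff ℝ (⊤ : ℕ∞) p :=
    contDiff_const.mul (hφ.comp (contDiff_const.mul (contDiff_id.sub contDiff_const)))
  have hpi : IntegrableOn p (Icc 0 1) := hpsm.continuous.integrableOn_Icc
  have hpnn : ∀ x, 0 ≤ p x := fun x => mul_nonneg (by positivity) (hφnn _)
  set m : ℝ := ∫ x in Icc (0 : ℝ) 1, p x with hm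
  have hm0 : 0 ≤ m := integral_nonneg hpnn
  have hind : Integrable ((Icc (t - h) (t + h)).indicator fun _ => h ^ β * c) :=
    (integrableOn_const (by simp)).integrable_indicator measurableSet_Icc
  have hple : ∀ x, p x ≤ (Icc (t - h) (t + h)).indicator (fun _ => h ^ β * c) x := fun x => by
    by_cases hx : x ∈ Icc (t - h) (t + h)
    · rw [indicator_of_mem hx]
      exact mul_le_mul_of_nonneg_left (hφc _) (by positivity)
    · rw [indicator_of_notMem hx]
      have : 1 < |h⁻¹ * (x - t)| := by
        rw [abs_mul, abs_of_pos (inv_pos.2 hh), ← div_eq_inv_mul, one_lt_div hh, lt_abs]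
        by_contra! hcon
        exact hx ⟨by linarith [hcon.2], by linarith [hcon.1]⟩
      simp [hp, hφz _ this]
  -- Enlarging the domain to `ℝ` covers `t` near an end point, where the bump overhangs `[0,1]`.
  have hmle : m ≤ 2 * c * h ^ (β + 1) := by
    calc m ≤ ∫ x in Icc (0 : ℝ) 1, (Icc (t - h) (t + h)).indicator (fun _ => h ^ β * c) x :=
          integral_mono hpi hind.integrableOn hple
      _ ≤ ∫ x, (Icc (t - h) (t + h)).indicator (fun _ => h ^ β * c) x :=
          setIntegral_le_integral hind (.of_forall fun x =>
            indicator_nonneg (fun _ _ => by positivity) x)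
      _ = _ := by
          rw [integral_indicator measurableSet_Icc, setIntegral_const, Real.volume_real_Icc_of_le
            (by linarith), smul_eq_mul]
          ring
  have hpow : h ^ (β + 1) ≤ h ^ β * (1 / 4) := by rw [pow_succ]; gcongr
  have hpow1 : h ^ β ≤ 1 := pow_le_one₀ hh.le (by linarith)
  have hpβ : 0 < h ^ β := by positivity
  have hm1 : m ≤ 1 := by nlinarith
  have hgcont : Continuous fun x => p x - m := hpsm.continuous.sub continuous_const
  have hgint : ∫ x in Icc (0 : ℝ) 1, (p x - m) = 0 := by
    rw [integral_sub hpi (integrableOn_const (by simp))]; simp [hm]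
  refine ⟨fun x => p x - m, hgcont, hgint, ⟨⟨fun x _ => ?_, ?_, ?_⟩, ?_⟩, ?_, ?_⟩
  · linarith [hpnn x]
  · exact (continuous_const.add hgcont).integrableOn_Icc
  · rw [integral_add (integrable_const _) hgcont.integrableOn_Icc, hgint]; simp
  · refine isSobolev_of_contDiff (contDiff_const.add (hpsm.sub contDiff_const)) fun x => ?_
    have e : (fun x => 1 + (p x - m)) = fun x => (1 - m) + p x := by funext x; ring
    have e2 : iteratedDeriv β (fun x => 1 + (p x - m)) x
        = iteratedDeriv β φ (h⁻¹ * (x - t)) := by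
      rw [e, iteratedDeriv_const_add hβ, hp, iteratedDeriv_const_mul_field,
        iteratedDeriv_comp_sub_const β (fun y => φ (h⁻¹ * y)),
        iteratedDeriv_comp_const_mul (hφ.of_le (by exact_mod_cast le_top))]
      simp only
      rw [← mul_assoc, ← mul_pow, mul_inv_cancel₀ hh.ne', one_pow, one_mul]
    rw [e2]; exact hφd _
  · have : p t = h ^ β * c := by simp [hp, hφ0]
    refine le_trans ?_ (le_abs_self _)
    simp only [this]
    -- As `h ≤ 1/4`, the mean `m` is at most half the peak `c * h ^ β`; hence the constant `c / 2`.
    nlinarith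
  · calc _ ≤ ∫ x in Icc (0 : ℝ) 1, (p x + m) := by
          refine integral_mono hgcont.abs.integrableOn_Icc
            (hpsm.continuous.add continuous_const).integrableOn_Icc fun x => ?_
          exact abs_le.2 ⟨by linarith [hpnn x], by linarith⟩
      _ = 2 * m := by
          rw [integral_add hpi (integrableOn_const (by simp))]; simp [hm]; ring
      _ ≤ h ^ (β + 1) := by
          have : 0 < h ^ (β + 1) := by positivity
          nlinarith

/-! ### Private samples and the choice of bandwidth. -/

theorem isProbabilityMeasure_rawLaw {f : ℝ → ℝ} (hf : IsDensity f) :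
    IsProbabilityMeasure (rawLaw f) := by
  refine ⟨?_⟩
  rw [rawLaw, withDensity_apply _ MeasurableSet.univ, setLIntegral_univ,
    Measure.Subtype.volume_def, lintegral_subtype_comap measurableSet_Icc (fun x => ENNReal.ofReal (f x)),
    ← ofReal_integral_eq_lintegral_ofReal hf.integrableOn, hf.integral_eq_one, ENNReal.ofReal_one]
  exact (ae_restrict_iff' measurableSet_Icc).2 (.of_forall hf.nonneg)

/-- Second-moment comparison of the privatised samples under the uniform density and a
perturbation of it. -/
theorem sq_lintegral_privateSampleLaw_le {Z : Type*} [MeasurableSpace Z] {α : ℝ} (hα : 0 < α)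
    {Q : Kernel (Icc (0 : ℝ) 1) Z} (hQ : IsLocallyPrivate α Q) {g : ℝ → ℝ} (hg : Continuous g)
    (hg0 : ∫ x in Icc (0 : ℝ) 1, g x = 0) (hd : IsDensity fun x => 1 + g x) {η : ℝ} (hη : 0 ≤ η)
    (hgη : ∫ x in Icc (0 : ℝ) 1, |g x| ≤ η) (hη1 : (Real.exp α - 1) * η ≤ 1) (n : ℕ)
    {F : (Fin n → Z) → ℝ≥0∞} (hF : Measurable F) :
    (∫⁻ z, F z ∂(privateSampleLaw n (fun x => 1 + g x) Q)) ^ 2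
      ≤ ENNReal.ofReal (1 + ((Real.exp α - 1) * η) ^ 2) ^ n
        * ∫⁻ z, F z ^ 2 ∂(privateSampleLaw n (fun _ => 1) Q) := by
  have := hQ.isMarkov
  have := isProbabilityMeasure_rawLaw hd
  have he : 0 ≤ Real.exp α - 1 := by linarith [Real.one_le_exp hα.le]
  have h1 : rawLaw (fun _ => 1) = volume := by simp [rawLaw]
  have hgi : Integrable (fun x : Icc (0 : ℝ) 1 => g x) :=
    (integrableOn_iff_comap_subtypeVal measurableSet_Icc).1 hg.integrableOn_Icc
  have hclose : ∀ B, MeasurableSet B →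
      |((rawLaw fun x => 1 + g x).bind Q).real B - ((volume : Measure (Icc (0 : ℝ) 1)).bind Q).real B|
        ≤ (Real.exp α - 1) * η * ((volume : Measure (Icc (0 : ℝ) 1)).bind Q).real B := by
    intro B hB
    refine (hQ.abs_bind_sub_le hα (μ := volume) (g := fun x : Icc (0 : ℝ) 1 => g x)
      (by fun_prop) hgi ?_ (fun x => hd.nonneg x x.2) hB).trans ?_
    · rw [integral_subtype measurableSet_Icc, hg0]
    · gcongr
      rwa [integral_subtype measurableSet_Icc (fun x => |g x|)]
  unfold privateSampleLaw
  rw [h1]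
  refine sq_lintegral_pi_le (fun F hF => ?_) n F hF
  refine sq_lintegral_le_of_near (mul_nonneg he hη) hη1 (fun B hB => ?_) (fun B hB => ?_) hF
  · linarith [(abs_le.1 (hclose B hB)).2]
  · linarith [(abs_le.1 (hclose B hB)).1]

/-- The minimax lower bound for a bandwidth `h` with `n (exp α - 1)² h ^ (2β + 2) = 1`. -/
theorem le_normalisedMinimaxRisk {β : ℕ} (hβ : 1 ≤ β) {L : ℝ} (hL : 0 < L) :
    ∃ C : ℝ, 0 < C ∧ ∀ t ∈ Icc (0 : ℝ) 1, ∀ α : ℝ, 0 < α → ∀ (n : ℕ) (h : ℝ), 0 < n → 0 < h →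
      h ≤ 1 / 4 → (n : ℝ) * (Real.exp α - 1) ^ 2 * h ^ (2 * β + 2) = 1 →
      normalisation β α n * h ^ (2 * β) = 1 →
      ENNReal.ofReal C ≤ normalisedMinimaxRisk.{u} (sobolevDensities β L) β α t n := by
  obtain ⟨c, hc, H⟩ := exists_perturbation hβ hL
  -- Half the separation `c * h ^ β` serves as `δ`, and `3` bounds `exp 1`.
  refine ⟨(c / 2) ^ 2 / (4 * 3), by positivity, fun t ht α hα n h hn hh hh4 hN hnorm => ?_⟩
  obtain ⟨g, hg, hg0, hmem, hgt, hgL⟩ := H t ht h hh hh4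
  unfold normalisedMinimaxRisk
  refine le_iInf fun Z => le_iInf fun _ => le_iInf fun Q => le_iInf fun hQ => le_iInf fun T =>
    le_iInf fun hT => ?_
  have := hQ.isMarkov
  have := isProbabilityMeasure_rawLaw hmem.1
  have : IsProbabilityMeasure (privateSampleLaw n (fun x => 1 + g x) Q) := by
    unfold privateSampleLaw; infer_instance
  set ε := (Real.exp α - 1) * h ^ (β + 1) with hε
  have he : 0 ≤ Real.exp α - 1 := by linarith [Real.one_le_exp hα.le]
  have hε0 : 0 ≤ ε := mul_nonneg he (by positivity)
  have hnε : (n : ℝ) * ε ^ 2 = 1 := by rw [← hN, hε]; ring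
  have hn1 : (1 : ℝ) ≤ n := by exact_mod_cast hn
  have hε1 : ε ≤ 1 := by nlinarith [sq_nonneg ε]
  have hK : ENNReal.ofReal (1 + ε ^ 2) ^ n ≤ ENNReal.ofReal 3 := by
    rw [← ENNReal.ofReal_pow (by positivity)]
    apply ENNReal.ofReal_le_ofReal
    calc (1 + ε ^ 2) ^ n ≤ Real.exp (ε ^ 2) ^ n := by
          gcongr; linarith [Real.add_one_le_exp (ε ^ 2)]
      _ = Real.exp 1 := by rw [← Real.exp_nat_mul, hnε]
      _ ≤ 3 := by linarith [Real.exp_one_lt_d9]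
  have hsnn : 0 ≤ normalisation β α n := Real.rpow_nonneg (by positivity) _
  have hconst : (c / 2) ^ 2 / (4 * 3) = normalisation β α n * (c / 2 * h ^ β) ^ 2 / (4 * 3) := by
    rw [mul_pow, ← pow_mul, mul_comm β 2, mul_left_comm, hnorm, mul_one]
  rw [hconst]
  rcases two_point_bound (K := 3) (by norm_num)
    (fun F hF => (sq_lintegral_privateSampleLaw_le hα hQ hg hg0 hmem.1 (by positivity) hgL hε1 n
      hF).trans (by gcongr)) hT (a := 1) (b := 1 + g t) (δ := c / 2 * h ^ β) (by positivity) hsnn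
      (by rw [add_sub_cancel_left]; linarith) with h0 | h1
  · exact h0.trans (le_iSup₂_of_le (fun _ => 1) (one_mem_sobolevDensities hβ hL) le_rfl)
  · exact h1.trans (le_iSup₂_of_le (fun x => 1 + g x) hmem le_rfl)

/-- The bandwidth `(n (exp α - 1)²)^(-1 / (2β + 2))`. -/
theorem eventually_exists_bandwidth (β : ℕ) {α : ℝ} (hα : 0 < α) :
    ∀ᶠ n : ℕ in atTop, ∃ h : ℝ, 0 < n ∧ 0 < h ∧ h ≤ 1 / 4 ∧
      (n : ℝ) * (Real.exp α - 1) ^ 2 * h ^ (2 * β + 2) = 1 ∧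
      normalisation β α n * h ^ (2 * β) = 1 := by
  have he : 0 < (Real.exp α - 1) ^ 2 := by
    have : 1 < Real.exp α := Real.one_lt_exp_iff.2 hα
    have : 0 < Real.exp α - 1 := by linarith
    positivity
  have hb : (0 : ℝ) < 1 / (2 * β + 2) := by positivity
  have hN : Tendsto (fun n : ℕ => (n : ℝ) * (Real.exp α - 1) ^ 2) atTop atTop :=
    tendsto_natCast_atTop_atTop.atTop_mul_const he
  have hlim := (tendsto_rpow_neg_atTop hb).comp hN
  filter_upwards [hlim.eventually_le_const (show (0 : ℝ) < 1 / 4 by norm_num),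
    eventually_gt_atTop 0] with n hn hn0
  have hpos : 0 < (n : ℝ) * (Real.exp α - 1) ^ 2 := mul_pos (by exact_mod_cast hn0) he
  refine ⟨_, hn0, Real.rpow_pos_of_pos hpos _, hn, ?_, ?_⟩
  · rw [← Real.rpow_natCast (_ ^ _), ← Real.rpow_mul hpos.le]
    nth_rw 1 [← Real.rpow_one ((n : ℝ) * (Real.exp α - 1) ^ 2)]
    rw [← Real.rpow_add hpos]
    push_cast
    rw [show (1 : ℝ) + -(1 / (2 * β + 2)) * (2 * β + 2) = 0 by field_simp; ring, Real.rpow_zero]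
  · rw [normalisation, ← Real.rpow_natCast (_ ^ _), ← Real.rpow_mul hpos.le,
      ← Real.rpow_add hpos]
    push_cast
    rw [show 2 * (β : ℝ) / (2 * β + 2) + -(1 / (2 * β + 2)) * (2 * β) = 0 by field_simp; ring,
      Real.rpow_zero]

end PrivateDensity

theorem mainTheorem4 (β : ℕ) (hβ : 1 ≤ β) (L : ℝ) (hL : 0 < L) :
    ∃ C : ℝ, 0 < C ∧ ∀ t ∈ Set.Icc (0 : ℝ) 1, ∀ α : ℝ, 0 < α →
      ENNReal.ofReal C ≤
        Filter.liminf
          (fun n : ℕ => PrivateDensity.normalisedMinimaxRisk.{u}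
            (PrivateDensity.sobolevDensities β L) β α t n)
          Filter.atTop := by
  obtain ⟨C, hC, H⟩ := PrivateDensity.le_normalisedMinimaxRisk hβ hL
  refine ⟨C, hC, fun t ht α hα => Filter.le_liminf_of_le (by isBoundedDefault) ?_⟩
  filter_upwards [PrivateDensity.eventually_exists_bandwidth β hα] with n ⟨h, hn, hh, hh4, h1, h2⟩
  exact H t ht α hα n h hn hh hh4 h1 h2
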